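/- Let $n\ge 2$, let $\tilde\theta:\mathbb Z/n\mathbb Z\to\mathbb R$, and let $\mathcal H_n$ be the complex Hilbert space with orthonormal basis $|j,J\rangle=|j\rangle\otimes|J\rangle$, $j\in\mathbb Z/n\mathbb Z$, $J\in\{L,R\}$, where $|L\rangle={}^T[1,0]$ and $|R\rangle={}^T[0,1]$. For $2\times 2$ matrices $C_j$ ($j\in\mathbb Z/n\mathbb Z$) let $\mathcal C_n=\sum_j |j\rangle\langle j|\otimes C_j$, let $S_n^{MS}$ be the moving shift, $S_n^{MS}|j,R\rangle=|j+1,R\rangle$, $S_n^{MS}|j,L\rangle=|j-1,L\rangle$ (positions modulo $n$), and let $U_n^{MS}(\mathcal C_n)=S_n^{MS}\mathcal C_n$. For an operator $U$ on $\mathcal H_n$ let $T_n(U)=\inf\{t\in\mathbb Z_{\ge 1}: U^t=I\}$, with $\inf\emptyset=\infty$. Let $\mathcal C_n'$ be the coin operator with $$C_j'=\frac1{\sqrt2}\begin{bmatrix} e^{i\tilde\theta(j)} & 1\\ 1 & -e^{-i\tilde\theta(j)}\end{bmatrix}.$$ If $\sum_{j}\tilde\theta(j)=2\pi k$ for some $k\in\mathbb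 Z$, then $$T_n(U_n^{MS}(\mathcal C_n'))=\begin{cases}2 & (n=2)\\ 8 & (n=4)\\ 24 & (n=8)\\ \infty & (n\ne 2,4,8).\end{cases}$$ In particular, $T_n(U_n^{MS}(\mathcal C_n'))$ equals the period of the homogeneous Hadamard walk, that is, of $U_n^{MS}(\mathcal C_n)$ with $C_j=\frac1{\sqrt2}\begin{bmatrix}1&1\\1&-1\end{bmatrix}$ for all $j$. -/

import Mathlib

open scoped Kronecker

namespace CycleWalk

/-- Index set of the orthonormal basis `|i, J⟩ = |i⟩ ⊗ |J⟩` of the state space of the walk on the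
`n`-cycle: the vertices are `ZMod n`, and the chirality `J : Fin 2` is `0` for `L`, `1` for `R`. -/
abbrev Site (n : ℕ) : Type := ZMod n × Fin 2

/-- Operators on the state space, as matrices in the basis `|i, J⟩`. -/
abbrev Op (n : ℕ) : Type := Matrix (Site n) (Site n) ℂ

/-- The coin operator `∑ i, |i⟩⟨i| ⊗ C i`. -/
noncomputable def coinOperator (n : ℕ) [NeZero n] (C : ZMod n → Matrix (Fin 2) (Fin 2) ℂ) : Op n :=
  ∑ i : ZMod n, Matrix.single i i (1 : ℂ) ⊗ₖ C i

/-- The basis vector to which the moving shift sends a basis vector: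
`|i, R⟩ ↦ |i + 1, R⟩` and `|i, L⟩ ↦ |i - 1, L⟩`. -/
def moveSite {n : ℕ} (x : Site n) : Site n :=
  if x.2 = 1 then (x.1 + 1, 1) else (x.1 - 1, 0)

/-- The moving shift operator: column `y` is the basis vector `|moveSite y⟩`. -/
def movingShift (n : ℕ) : Op n :=
  Matrix.of fun x y => if x = moveSite y then 1 else 0

/-- The time evolution operator of the moving-shift walk with site coins `C i`. -/
noncomputable def movingEvolution (n : ℕ) [NeZero n] (C : ZMod n → Matrix (Fin 2) (Fin 2) ℂ) :
    Op n :=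
  movingShift n * coinOperator n C

/-- The period: the infimum in `ℕ∞` of the integers `t ≥ 1` such that `U ^ t` is the identity; it is
`⊤` if there is no such `t`. -/
noncomputable def period {n : ℕ} [NeZero n] (U : Op n) : ℕ∞ :=
  sInf ((fun t : ℕ => (t : ℕ∞)) '' {t : ℕ | 1 ≤ t ∧ U ^ t = 1})

/-- The coin `(1/√2) [[e^{iθ}, 1], [1, -e^{-iθ}]]`. -/
noncomputable def phaseCoin (θ : ℝ) : Matrix (Fin 2) (Fin 2) ℂ :=
  ((1 / √2 : ℝ) : ℂ) •
    !![Complex.exp (Complex.I * θ), 1;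
       1, -Complex.exp (-(Complex.I * θ))]

/-- The Hadamard coin `(1/√2) [[1, 1], [1, -1]]`. -/
noncomputable def hadamardCoin : Matrix (Fin 2) (Fin 2) ℂ :=
  ((1 / √2 : ℝ) : ℂ) • !![1, 1; 1, -1]

end CycleWalk

namespace CycleWalk

/-! A diagonal gauge change conjugates the phase walk to the Hadamard walk; it closes up around the
cycle because the total phase lies in 2πℤ (`phase_pow_eq_one_iff`). On plane waves `w ^ j`, `w ^ n =
1`, the Hadamard walk has eigenvalues `l` with `l - l⁻¹ = (w - w⁻¹)/√2`. A finite period makes `l` a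
root of unity, so `(1 - w²)²/2` is an algebraic integer; multiplying over the nontrivial powers of
`w²` gives a divisibility leaving only `n = 2, 4, 8` (`hadamard_finite_period`). There, polynomial
identities bound the period above, and explicit eigenvalues bound it below. -/

/-- The inverse of `moveSite`. -/
def unmoveSite {n : ℕ} (x : Site n) : Site n :=
  if x.2 = 1 then (x.1 - 1, 1) else (x.1 + 1, 0)

theorem eq_moveSite_iff {n : ℕ} (x y : Site n) : x = moveSite y ↔ y = unmoveSite x := by
  obtain ⟨i, J⟩ := x
  obtain ⟨j, K⟩ := y
  fin_cases J <;> fin_cases K <;> simp [moveSite, unmoveSite]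
  · rw [eq_sub_iff_add_eq, eq_comm]
  · rw [eq_sub_iff_add_eq, eq_comm]

theorem coinOperator_apply (n : ℕ) [NeZero n] (C : ZMod n → Matrix (Fin 2) (Fin 2) ℂ)
    (x y : Site n) : coinOperator n C x y = if x.1 = y.1 then C x.1 x.2 y.2 else 0 := by
  obtain ⟨i, J⟩ := x
  obtain ⟨j, K⟩ := y
  simp only [coinOperator, Matrix.sum_apply, Matrix.kroneckerMap_apply, Matrix.single_apply]
  rw [Finset.sum_eq_single i (fun b _ hb => by simp [hb]) (by simp)]
  by_cases h : i = j <;> simp [h]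

theorem movingEvolution_apply (n : ℕ) [NeZero n] (C : ZMod n → Matrix (Fin 2) (Fin 2) ℂ)
    (x y : Site n) : movingEvolution n C x y =
      if (unmoveSite x).1 = y.1 then C y.1 x.2 y.2 else 0 := by
  simp only [movingEvolution, Matrix.mul_apply, movingShift, Matrix.of_apply, eq_moveSite_iff,
    ite_mul, one_mul, zero_mul, Finset.sum_ite_eq', Finset.mem_univ, if_true, coinOperator_apply]
  by_cases h : (unmoveSite x).1 = y.1
  · rw [if_pos h, if_pos h, h]
    congr 1
    obtain ⟨i, J⟩ := x
    fin_cases J <;> simp [unmoveSite]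
  · rw [if_neg h, if_neg h]

theorem movingEvolution_mulVec (n : ℕ) [NeZero n] (C : ZMod n → Matrix (Fin 2) (Fin 2) ℂ)
    (v : Site n → ℂ) (x : Site n) : (movingEvolution n C).mulVec v x =
      ∑ K, C (unmoveSite x).1 x.2 K * v ((unmoveSite x).1, K) := by
  simp only [Matrix.mulVec, dotProduct, movingEvolution_apply, Fintype.sum_prod_type, ite_mul,
    zero_mul]
  rw [Finset.sum_eq_single (unmoveSite x).1 (fun b _ hb => by simp [hb.symm]) (by simp)]
  simp

/-! ### Eigenvalues, integrality and the exclusion of other `n` -/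

/-- The constant `1/√2`. -/
noncomputable def invSqrtTwo : ℂ := ((1 / √2 : ℝ) : ℂ)

theorem invSqrtTwo_mul_self : invSqrtTwo * invSqrtTwo = 1 / 2 := by
  rw [invSqrtTwo, ← Complex.ofReal_mul, div_mul_div_comm, Real.mul_self_sqrt (by norm_num)]
  norm_num

theorem hadamard_mulVec_left (n : ℕ) [NeZero n] (v : Site n → ℂ) (j : ZMod n) :
    (movingEvolution n fun _ => hadamardCoin).mulVec v (j, 0) =
      invSqrtTwo * (v (j + 1, 0) + v (j + 1, 1)) := by
  simp [movingEvolution_mulVec, unmoveSite, hadamardCoin, invSqrtTwo]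
  ring

theorem hadamard_mulVec_right (n : ℕ) [NeZero n] (v : Site n → ℂ) (j : ZMod n) :
    (movingEvolution n fun _ => hadamardCoin).mulVec v (j, 1) =
      invSqrtTwo * (v (j - 1, 0) - v (j - 1, 1)) := by
  simp [movingEvolution_mulVec, unmoveSite, hadamardCoin, invSqrtTwo]
  ring

theorem eigenvalue_pow_eq_one {n : ℕ} [NeZero n] {w l : ℂ} (hw : w ^ n = 1)
    (hl : l ^ 2 = 1 + invSqrtTwo * (w - w⁻¹) * l) {t : ℕ}
    (ht : (movingEvolution n fun _ => hadamardCoin) ^ t = 1) : l ^ t = 1 := by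
  have hw0 : w ≠ 0 := by
    rintro rfl
    simp [NeZero.ne n] at hw
  let χ := AddChar.zmodChar n hw
  have h1 : χ 1 = w := by
    have := AddChar.zmodChar_apply' hw 1
    simpa using this
  have hadd (j : ZMod n) : χ (j + 1) = χ j * w := by rw [AddChar.map_add_eq_mul, h1]
  have hsub (j : ZMod n) : χ (j - 1) = χ j * w⁻¹ := by
    have := hadd (j - 1)
    rw [sub_add_cancel] at this
    rw [this, mul_assoc, mul_inv_cancel₀ hw0, mul_one]
  have hs := invSqrtTwo_mul_self
  have hs0 : invSqrtTwo ≠ 0 := by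
    intro h
    simp [h] at hs
  -- The left row of the eigenvalue equation fixes the ratio of the two amplitudes; the right row is
  -- then `hl`.
  let v : Site n → ℂ := fun x => χ x.1 * (if x.2 = 0 then invSqrtTwo * w else l - invSqrtTwo * w)
  have hv : (movingEvolution n fun _ => hadamardCoin).mulVec v = l • v := by
    ext ⟨j, J⟩
    fin_cases J
    · simp only [Fin.zero_eta, hadamard_mulVec_left, v, hadd, Pi.smul_apply, smul_eq_mul]
      simp
      ring
    · simp only [Fin.mk_one, hadamard_mulVec_right, v, hsub, Pi.smul_apply, smul_eq_mul]
      simp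
      have : w⁻¹ * w = 1 := inv_mul_cancel₀ hw0
      linear_combination (-χ j) * hl + 2 * χ j * invSqrtTwo * invSqrtTwo * this + 2 * χ j * hs
  have hpow (k : ℕ) : ((movingEvolution n fun _ => hadamardCoin) ^ k).mulVec v = l ^ k • v := by
    induction k with
    | zero => simp
    | succ k ih =>
      rw [pow_succ, ← Matrix.mulVec_mulVec, hv, Matrix.mulVec_smul, ih, smul_smul, pow_succ']
  have h := congrFun (hpow t) (0, 0)
  rw [ht, Matrix.one_mulVec] at h
  have hv0 : v (0, 0) ≠ 0 := by simp [v, hs0, hw0]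
  rw [Pi.smul_apply, smul_eq_mul] at h
  exact mul_right_cancel₀ hv0 (by rw [← h, one_mul])

theorem isIntegral_half_one_sub_sq {n : ℕ} [NeZero n] {w : ℂ} (hw : w ^ n = 1) {t : ℕ}
    (ht0 : t ≠ 0) (ht : (movingEvolution n fun _ => hadamardCoin) ^ t = 1) :
    IsIntegral ℤ ((1 - w ^ 2) ^ 2 / 2) := by
  have hw0 : w ≠ 0 := by
    rintro rfl
    simp [NeZero.ne n] at hw
  obtain ⟨l, hl⟩ : ∃ l : ℂ, l ^ 2 = 1 + invSqrtTwo * (w - w⁻¹) * l := by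
    obtain ⟨r, hr⟩ := IsAlgClosed.exists_pow_nat_eq
      ((invSqrtTwo * (w - w⁻¹)) ^ 2 + 4) (n := 2) (by norm_num)
    exact ⟨(invSqrtTwo * (w - w⁻¹) + r) / 2, by linear_combination hr / 4⟩
  have hlt := eigenvalue_pow_eq_one hw hl ht
  have hl0 : l ≠ 0 := by
    rintro rfl
    simp [ht0] at hlt
  have hli : IsIntegral ℤ l := IsIntegral.of_pow (Nat.pos_of_ne_zero ht0) (hlt ▸ isIntegral_one)
  have hlinv : IsIntegral ℤ l⁻¹ := IsIntegral.of_pow (Nat.pos_of_ne_zero ht0)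
    (by rw [inv_pow, hlt, inv_one]; exact isIntegral_one)
  have hwi : IsIntegral ℤ w := IsIntegral.of_pow (NeZero.pos n) (hw ▸ isIntegral_one)
  have h : l - l⁻¹ = invSqrtTwo * (w - w⁻¹) := by
    field_simp at hl ⊢
    linear_combination hl
  have : (1 - w ^ 2) ^ 2 / 2 = (w * (l - l⁻¹)) ^ 2 := by
    have hh : w * (w - w⁻¹) = w ^ 2 - 1 := by field_simp
    rw [h, show w * (invSqrtTwo * (w - w⁻¹)) = invSqrtTwo * (w ^ 2 - 1) by
      rw [← hh]; ring, mul_pow, sq invSqrtTwo, invSqrtTwo_mul_self]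
    ring
  rw [this]
  exact (hwi.mul (hli.sub hlinv)).pow 2

/-- Since `∏ (1 - z ^ k) = m + 1` over `1 ≤ k ≤ m`, the product of the given integers is the
rational `(m + 1)² / 2 ^ m`, hence lies in ℤ. -/
theorem two_pow_dvd_sq_of_isIntegral {m : ℕ} {z : ℂ} (hz : IsPrimitiveRoot z (m + 1))
    (h : ∀ j : ℕ, IsIntegral ℤ ((1 - z ^ j) ^ 2 / 2)) : 2 ^ m ∣ (m + 1) ^ 2 := by
  have hprod : IsIntegral ℤ (∏ k ∈ Finset.range m, ((1 - z ^ (k + 1)) ^ 2 / 2)) :=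
    IsIntegral.prod _ fun k _ => h (k + 1)
  rw [Finset.prod_div_distrib, Finset.prod_pow, hz.prod_one_sub_pow_eq_order, Finset.prod_const,
    Finset.card_range] at hprod
  have hq : IsIntegral ℤ (((m + 1 : ℚ) ^ 2 / 2 ^ m)) := by
    rw [← isIntegral_algebraMap_iff (algebraMap ℚ ℂ).injective]
    simpa using hprod
  obtain ⟨a, ha⟩ := IsIntegrallyClosed.isIntegral_iff.mp hq
  simp only [eq_intCast] at ha
  rw [eq_div_iff (by positivity)] at ha
  have : (2 ^ m : ℤ) ∣ (m + 1) ^ 2 := ⟨a, by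
    have : (a * 2 ^ m : ℤ) = (m + 1) ^ 2 := by exact_mod_cast ha
    rw [← this, mul_comm]⟩
  exact_mod_cast this

theorem le_three_of_two_pow_dvd_sq {m : ℕ} (h : 2 ^ m ∣ (m + 1) ^ 2) : m = 0 ∨ m = 1 ∨ m = 3 := by
  have hle := Nat.le_of_dvd (by positivity) h
  have hlt (k : ℕ) : (k + 6 + 1) ^ 2 < 2 ^ (k + 6) := by
    induction k with
    | zero => norm_num
    | succ k ih =>
      calc (k + 1 + 6 + 1) ^ 2 ≤ (k + 6 + 1) ^ 2 * 2 := by ring_nf; nlinarith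
        _ < 2 ^ (k + 6) * 2 := by omega
        _ = 2 ^ (k + 1 + 6) := by ring
  have hm : m < 6 := by
    by_contra! hm
    obtain ⟨k, rfl⟩ := Nat.exists_eq_add_of_le' hm
    exact absurd hle (not_le.mpr (hlt k))
  interval_cases m <;> revert h <;> decide

theorem hadamard_finite_period {n : ℕ} [NeZero n] (hn : 2 ≤ n) {t : ℕ} (ht0 : t ≠ 0)
    (ht : (movingEvolution n fun _ => hadamardCoin) ^ t = 1) : n = 2 ∨ n = 4 ∨ n = 8 := by
  have hw := Complex.isPrimitiveRoot_exp n (NeZero.ne n)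
  set w := Complex.exp (2 * Real.pi * Complex.I / n)
  have hint (j : ℕ) : IsIntegral ℤ ((1 - (w ^ 2) ^ j) ^ 2 / 2) := by
    rw [← pow_mul, mul_comm, pow_mul]
    exact isIntegral_half_one_sub_sq
      (by rw [← pow_mul, mul_comm, pow_mul, hw.pow_eq_one, one_pow]) ht0 ht
  -- `w ^ 2` has order `n / 2` for even `n` and `n` for odd `n`; this order must be 1, 2 or 4.
  obtain ⟨m, rfl | rfl⟩ := Nat.even_or_odd' n
  · obtain ⟨k, rfl⟩ := Nat.exists_eq_add_of_le' (show 1 ≤ m by omega)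
    have := le_three_of_two_pow_dvd_sq
      (two_pow_dvd_sq_of_isIntegral (hw.pow (by omega) rfl) hint)
    omega
  · have := le_three_of_two_pow_dvd_sq
      (two_pow_dvd_sq_of_isIntegral (hw.pow_of_coprime 2 (by simp)) hint)
    omega

/-! ### Gauging away the phases -/

theorem exists_gauge (n : ℕ) [NeZero n] (θ : ZMod n → ℝ)
    (hθ : ∃ k : ℤ, ∑ j : ZMod n, θ j = 2 * Real.pi * k) :
    ∃ g : ZMod n → ℂ, (∀ j, g j ≠ 0) ∧
      ∀ j, g j = Complex.exp (Complex.I * θ (j + 1)) * g (j + 1) := by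
  obtain ⟨k, hk⟩ := hθ
  let G : ℕ → ℂ := fun m =>
    Complex.exp (-(Complex.I * ∑ i ∈ Finset.range m, (θ ((i : ZMod n) + 1) : ℂ)))
  have hsum : ∑ i ∈ Finset.range n, (θ ((i : ZMod n) + 1) : ℂ) = 2 * Real.pi * k := by
    have h1 : ∑ i ∈ Finset.range n, θ ((i : ZMod n) + 1) = ∑ j : ZMod n, θ (j + 1) :=
      Finset.sum_nbij' (fun i => (i : ZMod n)) (fun j => j.val) (by simp)
        (by simp [ZMod.val_lt])
        (fun i hi => ZMod.val_cast_of_lt (Finset.mem_range.mp hi)) (by simp) (by simp)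
    have h2 : ∑ j : ZMod n, θ (j + 1) = ∑ j : ZMod n, θ j := Equiv.sum_comp (Equiv.addRight (1 : ZMod n)) θ
    have := h1.trans (h2.trans hk)
    exact_mod_cast this
  have hper : Function.Periodic G n := by
    intro m
    simp only [G]
    rw [Nat.add_comm m n, Finset.sum_range_add, hsum, Complex.exp_eq_exp_iff_exists_int]
    refine ⟨-k, ?_⟩
    simp
    ring
  refine ⟨fun j => G j.val, fun j => Complex.exp_ne_zero _, fun j => ?_⟩
  have h : G (j + 1).val = G (j.val + 1) := by
    rw [← hper.map_mod_nat (j.val + 1), ZMod.val_add]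
    congr 1
    rw [Nat.add_mod, ZMod.val_one_eq_one_mod]
    simp
  simp only [h]
  simp only [G, Finset.sum_range_succ, ← Complex.exp_add]
  congr 1
  simp
  ring

theorem phase_pow_eq_one_iff (n : ℕ) [NeZero n] (θ : ZMod n → ℝ)
    (hθ : ∃ k : ℤ, ∑ j : ZMod n, θ j = 2 * Real.pi * k) (t : ℕ) :
    (movingEvolution n fun j => phaseCoin (θ j)) ^ t = 1 ↔
      (movingEvolution n fun _ => hadamardCoin) ^ t = 1 := by
  obtain ⟨g, hg0, hg⟩ := exists_gauge n θ hθ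
  -- The off-diagonal coin entries carry no phase, which forces this shift by one between the
  -- chiralities.
  let d : Site n → ℂ := fun x => if x.2 = 0 then g x.1 else g (x.1 - 1)
  have hd0 (x : Site n) : d x ≠ 0 := by
    simp only [d]
    split_ifs <;> exact hg0 _
  have hsemi : SemiconjBy (Matrix.diagonal d) (movingEvolution n fun _ => hadamardCoin)
      (movingEvolution n fun j => phaseCoin (θ j)) := by
    ext ⟨i, J⟩ ⟨j, K⟩
    rw [Matrix.diagonal_mul, Matrix.mul_diagonal, movingEvolution_apply, movingEvolution_apply]
    have hgj := hg (j - 1)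
    rw [sub_add_cancel] at hgj
    have hgj' : Complex.exp (-(Complex.I * θ j)) * g (j - 1) = g j := by
      rw [hgj, ← mul_assoc, ← Complex.exp_add]
      simp
    split_ifs with h
    · fin_cases J <;> simp [unmoveSite] at h
      · obtain rfl : i = j - 1 := by rw [← h]; ring
        fin_cases K
        · simp [d, phaseCoin, hadamardCoin, hgj]
          ring
        · simp [d, phaseCoin, hadamardCoin]
          ring
      · obtain rfl : i = j + 1 := by rw [← h]; ring
        fin_cases K
        · simp [d, phaseCoin, hadamardCoin]
          ring
        · simp [d, phaseCoin, hadamardCoin, ← hgj']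
          ring
    · simp
  have hunit : IsUnit (Matrix.diagonal d) := by
    rw [Matrix.isUnit_diagonal]
    exact Pi.isUnit_iff.mpr fun x => (hd0 x).isUnit
  have hp := (hsemi.pow_right t).eq
  constructor <;> intro h <;> rw [h] at hp
  · exact hunit.mul_left_cancel (by rw [hp, one_mul, mul_one])
  · exact hunit.mul_right_cancel (by rw [← hp, one_mul, mul_one])

/-! ### Upper bounds for `n = 2, 4, 8` -/

/-- Translation of wave functions by one vertex. -/
noncomputable def translation (n : ℕ) (a : ZMod n) : Module.End ℂ (Site n → ℂ) :=
  LinearMap.funLeft ℂ ℂ fun x => (x.1 + a, x.2)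

theorem translation_mul (n : ℕ) (a b : ZMod n) :
    translation n a * translation n b = translation n (a + b) := by
  refine LinearMap.ext fun v => funext fun x => ?_
  simp [translation, LinearMap.funLeft_apply, add_assoc]

theorem translation_zero (n : ℕ) : translation n 0 = 1 := by
  refine LinearMap.ext fun v => funext fun x => ?_
  simp [translation, LinearMap.funLeft_apply]

theorem translation_pow (n : ℕ) (a : ZMod n) (k : ℕ) :
    translation n a ^ k = translation n (k * a) := by
  induction k with
  | zero => simp [translation_zero]
  | succ k ih =>
    rw [pow_succ, ih, translation_mul]
    congr 1
    push_cast
    ring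

theorem hadamard_commute_translation (n : ℕ) [NeZero n] (a : ZMod n) :
    Commute (Matrix.toLin' (movingEvolution n fun _ => hadamardCoin)) (translation n a) := by
  refine LinearMap.ext fun v => funext fun ⟨j, J⟩ => ?_
  fin_cases J <;>
  simp [translation, LinearMap.funLeft_apply, hadamard_mulVec_left, hadamard_mulVec_right,
    add_right_comm, sub_add_eq_add_sub]

theorem hadamard_sq (n : ℕ) [NeZero n] :
    Matrix.toLin' (movingEvolution n fun _ => hadamardCoin) ^ 2 =
      1 + invSqrtTwo • ((translation n 1 - translation n (-1)) *
        Matrix.toLin' (movingEvolution n fun _ => hadamardCoin)) := by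
  refine LinearMap.ext fun v => funext fun ⟨j, J⟩ => ?_
  have hs := invSqrtTwo_mul_self
  fin_cases J
  · simp [translation, LinearMap.funLeft_apply, hadamard_mulVec_left, hadamard_mulVec_right, sq]
    linear_combination 2 * v (j, 0) * hs
  · simp [translation, LinearMap.funLeft_apply, hadamard_mulVec_left, hadamard_mulVec_right, sq,
      ← sub_eq_add_neg]
    linear_combination 2 * v (j, 1) * hs

/-- With `t = s(T - T')`, `U² - 1 = tU` and `U⁴ + 1 = (t² + 2)U²`, while `t(t² + 2)` is a multiple
of `T² - T'² = 0`. -/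
theorem pow_eight_eq_one_of_sq_eq {R : Type*} [CommRing R] {s T T' U : R} (hs : 2 * s ^ 2 = 1)
    (hT : T * T' = 1) (hT4 : T ^ 4 = 1) (hU : U ^ 2 = 1 + s * (T - T') * U) : U ^ 8 = 1 := by
  have hT2 : T ^ 2 = T' ^ 2 := by
    linear_combination T' ^ 2 * hT4 - T ^ 2 * (T * T' + 1) * hT
  obtain ⟨t, ht⟩ : ∃ t, t = s * (T - T') := ⟨_, rfl⟩
  rw [← ht] at hU
  have h2 : t ^ 2 + 2 = s ^ 2 * (T + T') ^ 2 := by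
    rw [ht]
    linear_combination (-4 * s ^ 2) * hT - 2 * hs
  have h0 : t * (t ^ 2 + 2) = 0 := by
    rw [h2, ht]
    linear_combination s ^ 3 * (T + T') * hT2
  have e1 : U ^ 2 - 1 = t * U := by rw [hU]; ring
  have e2 : U ^ 4 + 1 = (t ^ 2 + 2) * U ^ 2 := by
    linear_combination (U ^ 2 - 1 + t * U) * e1
  have e3 : (U ^ 2 - 1) * (U ^ 4 + 1) = 0 := by
    rw [e1, e2]
    linear_combination U ^ 3 * h0
  linear_combination (U ^ 2 + 1) * e3

/-- Now `t(t² + 1)(t² + 2)` is a multiple of `T⁴ - T'⁴ = 0`; the extra factor gives `U⁴ - U² + 1`, a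
divisor of `U²⁴ - 1`. -/
theorem pow_twentyfour_eq_one_of_sq_eq {R : Type*} [CommRing R] {s T T' U : R}
    (hs : 2 * s ^ 2 = 1) (hT : T * T' = 1) (hT8 : T ^ 8 = 1)
    (hU : U ^ 2 = 1 + s * (T - T') * U) : U ^ 24 = 1 := by
  have hT4 : T ^ 4 = T' ^ 4 := by
    linear_combination T' ^ 4 * hT8 - T ^ 4 * ((T * T') ^ 3 + (T * T') ^ 2 + T * T' + 1) * hT
  obtain ⟨t, ht⟩ : ∃ t, t = s * (T - T') := ⟨_, rfl⟩
  rw [← ht] at hU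
  have h1 : t ^ 2 + 1 = s ^ 2 * (T ^ 2 + T' ^ 2) := by
    rw [ht]
    linear_combination (-2 * s ^ 2) * hT - hs
  have h2 : t ^ 2 + 2 = s ^ 2 * (T + T') ^ 2 := by
    rw [ht]
    linear_combination (-4 * s ^ 2) * hT - 2 * hs
  have h0 : t * (t ^ 2 + 1) * (t ^ 2 + 2) = 0 := by
    rw [h1, h2, ht]
    linear_combination s ^ 5 * (T + T') * hT4
  have e1 : U ^ 2 - 1 = t * U := by rw [hU]; ring
  have e2 : U ^ 4 + 1 = (t ^ 2 + 2) * U ^ 2 := by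
    linear_combination (U ^ 2 - 1 + t * U) * e1
  have e3 : U ^ 4 - U ^ 2 + 1 = (t ^ 2 + 1) * U ^ 2 := by linear_combination e2
  have e4 : (U ^ 2 - 1) * (U ^ 4 - U ^ 2 + 1) * (U ^ 4 + 1) = 0 := by
    rw [e1, e2, e3]
    linear_combination U ^ 5 * h0
  linear_combination
    ((U ^ 2 + 1) * (U ^ 4 + U ^ 2 + 1) * (U ^ 8 - U ^ 4 + 1)) * e4

/-- The Hadamard walk, the translations and the scalar `1/√2` live in a commutative algebra. -/
theorem exists_commRing_hadamard (n : ℕ) [NeZero n] :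
    ∃ (R : Type) (_ : CommRing R) (s T T' U : R), 2 * s ^ 2 = 1 ∧ T * T' = 1 ∧ T ^ n = 1 ∧
      U ^ 2 = 1 + s * (T - T') * U ∧
      ∀ t : ℕ, U ^ t = 1 → (movingEvolution n fun _ => hadamardCoin) ^ t = 1 := by
  set H := movingEvolution n fun _ => hadamardCoin with hH
  let S : Set (Module.End ℂ (Site n → ℂ)) :=
    {Matrix.toLin' H, translation n 1, translation n (-1)}
  have hTT (a b : ZMod n) : translation n a * translation n b = translation n b * translation n a :=
    by rw [translation_mul, translation_mul, add_comm]
  have hc (a : ZMod n) := (hadamard_commute_translation n a).eq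
  have hcomm : ∀ a ∈ S, ∀ b ∈ S, a * b = b * a := by
    rintro a (rfl | rfl | rfl) b (rfl | rfl | rfl)
    exacts [rfl, hc _, hc _, (hc _).symm, rfl, hTT _ _, (hc _).symm, hTT _ _, rfl]
  let U : Algebra.adjoin ℂ S := ⟨Matrix.toLin' H, Algebra.subset_adjoin (by simp [S])⟩
  let T : Algebra.adjoin ℂ S := ⟨translation n 1, Algebra.subset_adjoin (by simp [S])⟩
  let T' : Algebra.adjoin ℂ S := ⟨translation n (-1), Algebra.subset_adjoin (by simp [S])⟩
  have := Algebra.isMulCommutative_adjoin ℂ hcomm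
  refine ⟨Algebra.adjoin ℂ S, { (inferInstance : Ring (Algebra.adjoin ℂ S)) with
    mul_comm := this.is_comm.comm },
    algebraMap ℂ _ invSqrtTwo, T, T', U, ?_, ?_, ?_, ?_, ?_⟩
  · have h : (2 : ℂ) * invSqrtTwo ^ 2 = 1 := by
      rw [sq, invSqrtTwo_mul_self]
      norm_num
    have h2 := congrArg (algebraMap ℂ (Algebra.adjoin ℂ S)) h
    rw [map_mul, map_pow, map_ofNat, map_one] at h2
    exact h2
  · apply Subtype.ext
    change translation n 1 * translation n (-1) = 1
    rw [translation_mul, add_neg_cancel, translation_zero]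
  · apply Subtype.ext
    change translation n 1 ^ n = 1
    rw [translation_pow, CharP.cast_eq_zero, zero_mul, translation_zero]
  · apply Subtype.ext
    change Matrix.toLin' H ^ 2 = 1 + algebraMap ℂ _ invSqrtTwo *
      (translation n 1 - translation n (-1)) * Matrix.toLin' H
    rw [hH, hadamard_sq, mul_assoc, Algebra.smul_def]
  · intro t ht
    have h : Matrix.toLin' H ^ t = 1 := congrArg Subtype.val ht
    apply Matrix.toLin'.injective
    rw [Matrix.toLin'_pow, h, Matrix.toLin'_one]
    rfl

theorem hadamard_two_sq : (movingEvolution 2 fun _ => hadamardCoin) ^ 2 = 1 := by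
  apply Matrix.toLin'.injective
  -- On two vertices the two unit translations coincide, so the linear term vanishes.
  rw [Matrix.toLin'_pow, hadamard_sq, show (-1 : ZMod 2) = 1 by decide, sub_self, zero_mul,
    smul_zero, add_zero, Matrix.toLin'_one]
  rfl

theorem hadamard_four_pow : (movingEvolution 4 fun _ => hadamardCoin) ^ 8 = 1 := by
  obtain ⟨R, _, s, T, T', U, hs, hT, hTn, hU, h⟩ := exists_commRing_hadamard 4
  exact h 8 (pow_eight_eq_one_of_sq_eq hs hT hTn hU)

theorem hadamard_eight_pow : (movingEvolution 8 fun _ => hadamardCoin) ^ 24 = 1 := by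
  obtain ⟨R, _, s, T, T', U, hs, hT, hTn, hU, h⟩ := exists_commRing_hadamard 8
  exact h 24 (pow_twentyfour_eq_one_of_sq_eq hs hT hTn hU)

/-! ### Lower bounds from explicit eigenvalues -/

/-- The eighth root of unity `(1 + i)/√2`. -/
noncomputable def zetaEight : ℂ := invSqrtTwo * (1 + Complex.I)

theorem zetaEight_sq : zetaEight ^ 2 = Complex.I := by
  have hs := invSqrtTwo_mul_self
  have hI := Complex.I_sq
  rw [zetaEight]
  linear_combination (1 + Complex.I) ^ 2 * hs + hI / 2

theorem zetaEight_pow_four : zetaEight ^ 4 = -1 := by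
  rw [show zetaEight ^ 4 = (zetaEight ^ 2) ^ 2 by ring, zetaEight_sq, Complex.I_sq]

theorem zetaEight_primitive : IsPrimitiveRoot zetaEight 8 := by
  refine IsPrimitiveRoot.iff_orderOf.mpr (orderOf_eq_prime_pow (p := 2) (n := 2) ?_ ?_)
  · norm_num [zetaEight_pow_four]
  · norm_num
    rw [show zetaEight ^ 8 = (zetaEight ^ 4) ^ 2 by ring, zetaEight_pow_four]
    norm_num

/-- The wave `w = i` has `zetaEight` as an eigenvalue. -/
theorem eight_dvd {n : ℕ} [NeZero n] (hn : 4 ∣ n) {t : ℕ}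
    (ht : (movingEvolution n fun _ => hadamardCoin) ^ t = 1) : 8 ∣ t := by
  refine zetaEight_primitive.dvd_of_pow_eq_one t (eigenvalue_pow_eq_one (w := Complex.I) ?_ ?_ ht)
  · obtain ⟨k, rfl⟩ := hn
    rw [pow_mul, Complex.I_pow_four, one_pow]
  · have hs := invSqrtTwo_mul_self
    rw [zetaEight_sq, Complex.inv_I, zetaEight]
    linear_combination (-2 * Complex.I * (1 + Complex.I)) * hs - Complex.I_sq

/-- For `w = zetaEight` the eigenvalue equation is `l² = 1 + i l`. Its roots satisfy `l³ = i` and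
`l⁴ ≠ 1`, so `l⁴` has order 3. -/
theorem three_dvd {t : ℕ} (ht : (movingEvolution 8 fun _ => hadamardCoin) ^ t = 1) : 3 ∣ t := by
  obtain ⟨l, hl⟩ : ∃ l : ℂ, l ^ 2 = 1 + Complex.I * l := by
    obtain ⟨r, hr⟩ := IsAlgClosed.exists_pow_nat_eq (3 : ℂ) (n := 2) (by norm_num)
    exact ⟨(Complex.I + r) / 2, by linear_combination hr / 4 - Complex.I_sq / 4⟩
  have hw : zetaEight * zetaEight ^ 7 = 1 := by
    rw [← pow_succ']
    exact zetaEight_primitive.pow_eq_one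
  have h1 : l ^ t = 1 := by
    refine eigenvalue_pow_eq_one (w := zetaEight) zetaEight_primitive.pow_eq_one ?_ ht
    have hs := invSqrtTwo_mul_self
    have h7 : zetaEight ^ 7 = -(Complex.I * zetaEight) := by
      rw [show zetaEight ^ 7 = zetaEight ^ 4 * zetaEight ^ 2 * zetaEight by ring,
        zetaEight_pow_four, zetaEight_sq]
      ring
    rw [inv_eq_of_mul_eq_one_right hw, hl, h7, zetaEight]
    have hI := Complex.I_sq
    linear_combination (-(1 + Complex.I) ^ 2 * l) * hs - l / 2 * hI
  have hl3 : l ^ 3 = Complex.I := by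
    linear_combination (l + Complex.I) * hl + l * Complex.I_sq
  have hne : l ^ 4 ≠ 1 := by
    intro h
    have h2 : Complex.I * l = 1 := by rw [← hl3, ← pow_succ, h]
    have h3 : l = -Complex.I := by linear_combination (-Complex.I) * h2 + l * Complex.I_sq
    rw [h3] at hl
    have : (3 : ℂ) = 0 := by linear_combination (-1 : ℂ) * hl + 2 * Complex.I_sq
    norm_num at this
  have h12 : (l ^ 4) ^ 3 = 1 := by
    rw [← pow_mul, show 4 * 3 = 3 * 4 by rfl, pow_mul, hl3, Complex.I_pow_four]
  have : orderOf (l ^ 4) = 3 := orderOf_eq_prime h12 hne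
  rw [← this]
  exact orderOf_dvd_of_pow_eq_one (by rw [← pow_mul, mul_comm, pow_mul, h1, one_pow])

theorem two_dvd {n : ℕ} [NeZero n] {t : ℕ}
    (ht : (movingEvolution n fun _ => hadamardCoin) ^ t = 1) : 2 ∣ t := by
  have h : (-1 : ℂ) ^ t = 1 := eigenvalue_pow_eq_one (w := 1) (one_pow n) (by simp) ht
  exact (neg_one_pow_eq_one_iff_even (by norm_num)).mp h |>.two_dvd

theorem period_eq_of_dvd {n : ℕ} [NeZero n] {U : Op n} {N : ℕ} (hN : 1 ≤ N) (h : U ^ N = 1)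
    (hd : ∀ t, U ^ t = 1 → N ∣ t) : period U = N := by
  refine le_antisymm (sInf_le ⟨N, ⟨hN, h⟩, rfl⟩) (le_sInf ?_)
  rintro _ ⟨t, ⟨ht1, ht⟩, rfl⟩
  exact Nat.cast_le.mpr (Nat.le_of_dvd ht1 (hd t ht))

theorem hadamard_period (n : ℕ) [NeZero n] (hn : 2 ≤ n) :
    period (movingEvolution n fun _ => hadamardCoin) =
      if n = 2 then 2 else if n = 4 then 8 else if n = 8 then 24 else ⊤ := by
  split_ifs with h2 h4 h8
  · subst h2
    exact period_eq_of_dvd (by norm_num) hadamard_two_sq fun t ht => two_dvd ht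
  · subst h4
    exact period_eq_of_dvd (by norm_num) hadamard_four_pow fun t ht => eight_dvd (by norm_num) ht
  · subst h8
    refine period_eq_of_dvd (by norm_num) hadamard_eight_pow fun t ht => ?_
    exact Nat.Coprime.mul_dvd_of_dvd_of_dvd (by norm_num : Nat.Coprime 8 3)
      (eight_dvd (by norm_num) ht) (three_dvd ht)
  · rw [period, sInf_eq_top]
    rintro _ ⟨t, ⟨ht1, ht⟩, rfl⟩
    have := hadamard_finite_period hn (by omega) ht
    omega

theorem phase_period_eq (n : ℕ) [NeZero n] (θ : ZMod n → ℝ)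
    (hθ : ∃ k : ℤ, ∑ j : ZMod n, θ j = 2 * Real.pi * k) :
    period (movingEvolution n fun j => phaseCoin (θ j)) =
      period (movingEvolution n fun _ => hadamardCoin) := by
  simp only [period, phase_pow_eq_one_iff n θ hθ]

end CycleWalk

theorem mainTheorem2 (n : ℕ) [NeZero n] (hn : 2 ≤ n) (θ : ZMod n → ℝ)
    (hθ : ∃ k : ℤ, ∑ j : ZMod n, θ j = 2 * Real.pi * k) :
    CycleWalk.period (CycleWalk.movingEvolution n fun j => CycleWalk.phaseCoin (θ j)) =
        (if n = 2 then 2 else if n = 4 then 8 else if n = 8 then 24 else ⊤) ∧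
      CycleWalk.period (CycleWalk.movingEvolution n fun j => CycleWalk.phaseCoin (θ j)) =
        CycleWalk.period (CycleWalk.movingEvolution n fun _ => CycleWalk.hadamardCoin) :=
  ⟨(CycleWalk.phase_period_eq n θ hθ).trans (CycleWalk.hadamard_period n hn),
    CycleWalk.phase_period_eq n θ hθ⟩
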